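/- Conventions. For a bounded distributive lattice $L$, let $X_L$ be the set of its (proper) prime filters, ordered by inclusion. The canonical extension $L^\delta$ is the complete lattice, ordered by inclusion, of all upsets of $X_L$, with the embedding $L\hookrightarrow L^\delta$, $a\mapsto\widehat a=\{x\in X_L\mid a\in x\}$. (Up to isomorphism it is the unique completion of $L$ that is dense and compact.) For a Boolean algebra $B$ the order on $X_B$ is trivial, so $B^\delta=\mathcal P(X_B)$. If $D$ is a bounded sublattice of $B$ (that is, a sublattice containing $0$ and $1$), then $D^\delta$ is regarded as a complete sublattice of $B^\delta$ via the complete embedding $U\mapsto\{x\in X_B\mid x\cap D\in U\}$, which extends the inclusion $D\subseteq B$. For $v\in B^\delta$ put $\overline v=\bigwedge\{u\in D^\delta\mid v\le u\}$. The Booleanization $D^-$ of $D$ is the Boolean subalgebra of $B$ generated by $D$. We write $a-b=a\wedge\neg b$, and we regard $B$ as a subalgebra of $B^\delta$. Theorem. Let $B$ be a Boolean algebra, $I$ a directed partially ordered set, $\{S_i\}_{i\in I}$ a family of meet-semilattices, and $f_i\colon B\rightleftarrows S_i\colon g_i$ ($i\in I$) a family of adjunctions (that is, $f_i(x)\le s\iff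 x\le g_i(s)$ for all $x\in B$, $s\in S_i$) such that (D.1) $\operatorname{Im}(g_i)\subseteq\operatorname{Im}(g_j)$ for all $i\le j$ in $I$; (D.2) $D:=\bigcup_{i\in I}\operatorname{Im}(g_i)$ is a bounded sublattice of $B$. For $x\in B$ write $\overline{x}^{\,i}=g_if_i(x)$. For $b\in B$, $i\in I$ and $n\ge1$ define $$k_1=\overline b,\qquad k_{2n}=\overline{k_{2n-1}-b},\qquad k_{2n+1}=\overline{k_{2n}\wedge b}\qquad\text{in } B^\delta,$$ $$c_{1,i}=\overline b^{\,i},\qquad c_{2n,i}=\overline{c_{2n-1,i}-b}^{\,i},\qquad c_{2n+1,i}=\overline{c_{2n,i}\wedge b}^{\,i}\qquad\text{in } B.$$ If $b\in D^-$, then there are an integer $m\ge1$ and an $i\in I$ such that for every $j\in I$ with $i\le j$ $$b=k_1-(k_2-\cdots-(k_{2m-1}-k_{2m})\cdots)=\bigvee_{l=1}^m(k_{2l-1}-k_{2l})$$ $$\phantom{b}=c_{1,j}-(c_{2,j}-\cdots-(c_{2m-1,j}-c_{2m,j})\cdots)=\bigvee_{l=1}^m(c_{2l-1,j}-c_{2l,j}).$$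 Moreover, the sequences $k_1\ge k_2\ge\cdots$ and $c_{1,j}\ge c_{2,j}\ge\cdots$ are decreasing. -/

import Mathlib

/-! ### Prime filters, canonical extensions -/

/-- The set of (proper) prime filters of `L`, ordered by inclusion: the poset underlying the
Priestley dual space of `L`. -/
abbrev PrimeFilter (L : Type*) [Preorder L] : Type _ := {x : Order.PFilter L // x.IsPrime}

namespace PrimeFilter

theorem isPrime_of_def {L : Type*} [Lattice L] [BoundedOrder L] {F : Order.PFilter L}
    (hbot : ⊥ ∉ F) (hsup : ∀ a b, a ⊔ b ∈ F → a ∈ F ∨ b ∈ F) : F.IsPrime where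
  compl_ideal :=
    { IsLowerSet := fun _ _ hba ha hb => ha (Order.PFilter.mem_of_le hba hb)
      Nonempty := ⟨⊥, hbot⟩
      Directed := fun a ha b hb =>
        ⟨a ⊔ b, fun h => (hsup a b h).elim ha hb, le_sup_left, le_sup_right⟩ }

theorem sup_mem_iff {L : Type*} [Lattice L] (x : PrimeFilter L) (a b : L) :
    a ⊔ b ∈ x.1 ↔ a ∈ x.1 ∨ b ∈ x.1 := by
  constructor
  · intro h
    by_contra hab
    rw [not_or] at hab
    obtain ⟨c, hc, hac, hbc⟩ := x.2.compl_ideal.Directed a hab.1 b hab.2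
    exact hc (Order.PFilter.mem_of_le (sup_le hac hbc) h)
  · rintro (h | h)
    · exact Order.PFilter.mem_of_le le_sup_left h
    · exact Order.PFilter.mem_of_le le_sup_right h

theorem bot_notMem {L : Type*} [Lattice L] [BoundedOrder L] (x : PrimeFilter L) : ⊥ ∉ x.1 := by
  intro h
  obtain ⟨c, hc⟩ := x.2.compl_ideal.Nonempty
  exact hc (Order.PFilter.mem_of_le bot_le h)

/-- The map of dual spaces given by a bounded lattice homomorphism: inverse image of prime
filters. -/
def comap {L M : Type*} [Lattice L] [BoundedOrder L] [Lattice M] [BoundedOrder M]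
    (h : BoundedLatticeHom L M) (x : PrimeFilter M) : PrimeFilter L :=
  have hF : Order.IsPFilter {a : L | h a ∈ x.1} :=
    Order.IsPFilter.of_def ⟨⊤, by simp⟩
      (fun a ha b hb => ⟨a ⊓ b, by
        simpa using And.intro ha hb, inf_le_left, inf_le_right⟩)
      (fun {_ _} hab ha => Order.PFilter.mem_of_le (OrderHomClass.mono h hab) ha)
  ⟨hF.toPFilter, isPrime_of_def
    (fun hb => x.bot_notMem (by
      have hb' : h ⊥ ∈ x.1 := hb
      simpa using hb'))
    (fun a b hab => by
      have hab' : h (a ⊔ b) ∈ x.1 := hab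
      rw [map_sup, sup_mem_iff] at hab'
      exact hab')⟩

theorem mem_comap {L M : Type*} [Lattice L] [BoundedOrder L] [Lattice M] [BoundedOrder M]
    (h : BoundedLatticeHom L M) (x : PrimeFilter M) (a : L) :
    a ∈ (comap h x).1 ↔ h a ∈ x.1 := Iff.rfl

/-- Prime filters of a Boolean algebra are pairwise incomparable. -/
theorem eq_of_le {B : Type*} [BooleanAlgebra B] {x y : PrimeFilter B} (hxy : x ≤ y) : x = y := by
  refine le_antisymm hxy fun a ha => ?_
  have h : a ⊔ aᶜ ∈ x.1 := by simp
  rcases (x.sup_mem_iff a aᶜ).1 h with h | h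
  · exact h
  · exact absurd (by simpa using Order.PFilter.inf_mem ha (hxy h)) y.bot_notMem

end PrimeFilter

/-- `e : L → C` is a canonical extension of `L`: a dense and compact embedding of `L` in a
complete lattice. -/
structure IsCanonicalExtension {L C : Type*} [Lattice L] [BoundedOrder L] [CompleteLattice C]
    (e : BoundedLatticeHom L C) : Prop where
  injective : Function.Injective e
  dense_join_of_meets : ∀ u : C, ∃ 𝒮 : Set (Set L), u = ⨆ S ∈ 𝒮, ⨅ a ∈ S, e a
  dense_meet_of_joins : ∀ u : C, ∃ 𝒮 : Set (Set L), u = ⨅ S ∈ 𝒮, ⨆ a ∈ S, e a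
  compact : ∀ S T : Set L, ⨅ a ∈ S, e a ≤ ⨆ b ∈ T, e b →
    ∃ S' T' : Finset L, (S' : Set L) ⊆ S ∧ (T' : Set L) ⊆ T ∧
      S'.inf (fun a => e a) ≤ T'.sup (fun b => e b)

/-- The canonical extension `L^δ` of a bounded distributive lattice `L`: the complete lattice,
ordered by inclusion, of all upsets of the poset of prime filters of `L`. -/
def CanExt (L : Type*) [Preorder L] : CompleteSublattice (Set (PrimeFilter L)) :=
  .mk' {U | IsUpperSet U} (fun _ h => isUpperSet_sUnion h) (fun _ h => isUpperSet_sInter h)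

/-- The embedding of `L` in `L^δ`, sending `a` to the set `â` of prime filters that contain
`a`. -/
def CanExt.stone (L : Type*) [Lattice L] [BoundedOrder L] : BoundedLatticeHom L (CanExt L) where
  toFun a := ⟨{x | a ∈ x.1}, fun _ _ hxy ha => hxy ha⟩
  map_sup' a b := Subtype.ext (Set.ext fun x => x.sup_mem_iff a b)
  map_inf' _ _ := Subtype.ext (Set.ext fun _ => Order.PFilter.inf_mem_iff)
  map_top' := Subtype.ext (Set.ext fun x => iff_of_true x.1.top_mem trivial)
  map_bot' := Subtype.ext (Set.ext fun x => iff_of_false x.bot_notMem id)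

/-- The canonical extension `B^δ` of a Boolean algebra `B`: since the order on the dual space of
`B` is trivial, it is the full powerset of the set of prime filters of `B`. -/
abbrev BoolCanExt (B : Type*) [BooleanAlgebra B] : Type _ := Set (PrimeFilter B)

theorem BoolCanExt.mem_canExt {B : Type*} [BooleanAlgebra B] (u : BoolCanExt B) :
    u ∈ CanExt B :=
  fun _ _ hxy hx => PrimeFilter.eq_of_le hxy ▸ hx

/-- The embedding `b ↦ b̂` of `B` in `B^δ`. -/
def BoolCanExt.stone (B : Type*) [BooleanAlgebra B] : BoundedLatticeHom B (BoolCanExt B) where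
  toFun b := {x | b ∈ x.1}
  map_sup' a b := Set.ext fun x => x.sup_mem_iff a b
  map_inf' _ _ := Set.ext fun _ => Order.PFilter.inf_mem_iff
  map_top' := Set.ext fun x => iff_of_true x.1.top_mem trivial
  map_bot' := Set.ext fun x => iff_of_false x.bot_notMem id

/-- Prime filter theorem, in the form of compactness of the dual space. -/
theorem PrimeFilter.compact {L : Type*} [DistribLattice L] [BoundedOrder L] (S T : Set L)
    (h : ∀ x : PrimeFilter L, S ⊆ x.1 → ∃ b ∈ T, b ∈ x.1) :
    ∃ S' T' : Finset L, (S' : Set L) ⊆ S ∧ (T' : Set L) ⊆ T ∧ S'.inf id ≤ T'.sup id := by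
  classical
  by_contra hcon
  have hF : Order.IsPFilter {a : L | ∃ S' : Finset L, (S' : Set L) ⊆ S ∧ S'.inf id ≤ a} :=
    Order.IsPFilter.of_def ⟨⊤, ∅, by simp, by simp⟩
      (by
        rintro a ⟨S₁, h₁, ha⟩ b ⟨S₂, h₂, hb⟩
        refine ⟨a ⊓ b, ⟨S₁ ∪ S₂, by simp [h₁, h₂], ?_⟩, inf_le_left, inf_le_right⟩
        rw [Finset.inf_union]
        exact inf_le_inf ha hb)
      (by
        rintro a b hab ⟨S₁, h₁, ha⟩
        exact ⟨S₁, h₁, ha.trans hab⟩)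
  have hI : Order.IsIdeal {a : L | ∃ T' : Finset L, (T' : Set L) ⊆ T ∧ a ≤ T'.sup id} :=
    { IsLowerSet := by
        rintro a b hba ⟨T₁, h₁, ha⟩
        exact ⟨T₁, h₁, hba.trans ha⟩
      Nonempty := ⟨⊥, ∅, by simp, by simp⟩
      Directed := by
        rintro a ⟨T₁, h₁, ha⟩ b ⟨T₂, h₂, hb⟩
        refine ⟨a ⊔ b, ⟨T₁ ∪ T₂, by simp [h₁, h₂], ?_⟩, le_sup_left, le_sup_right⟩
        rw [Finset.sup_union]
        exact sup_le_sup ha hb }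
  have hdis : Disjoint (hF.toPFilter : Set L) (hI.toIdeal : Set L) := by
    rw [Set.disjoint_left]
    rintro a ⟨S₁, h₁, ha⟩ ⟨T₁, h₂, hb⟩
    exact hcon ⟨S₁, T₁, h₁, h₂, ha.trans hb⟩
  obtain ⟨J, hJ, hIJ, hFJ⟩ := DistribLattice.prime_ideal_of_disjoint_filter_ideal hdis
  let P := hJ.toPrimePair
  obtain ⟨b, hbT, hb⟩ := h ⟨P.F, P.F_isPrime⟩ (fun a ha => by
    have haF : a ∈ (hF.toPFilter : Set L) := ⟨{a}, by simpa using ha, by simp⟩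
    have haJ : a ∉ P.I := Set.disjoint_left.1 hFJ haF
    have : a ∈ (P.I : Set L)ᶜ := haJ
    rwa [P.compl_I_eq_F] at this)
  have hbJ : b ∈ P.I := hIJ ⟨{b}, by simpa using hbT, by simp⟩
  exact Set.disjoint_left.1 P.disjoint hbJ hb

theorem PrimeFilter.le_of_forall {L : Type*} [DistribLattice L] [BoundedOrder L] {a b : L}
    (h : ∀ x : PrimeFilter L, a ∈ x.1 → b ∈ x.1) : a ≤ b := by
  obtain ⟨S', T', hS, hT, hle⟩ := PrimeFilter.compact {a} {b}
    (fun x hx => ⟨b, rfl, h x (hx rfl)⟩)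
  have h₁ : a ≤ S'.inf id := Finset.le_inf fun c hc => (hS hc : c = a).ge
  have h₂ : T'.sup id ≤ b := Finset.sup_le fun c hc => (hT hc : c = b).le
  exact h₁.trans (hle.trans h₂)

/-- `L^δ` is a canonical extension of `L`. -/
theorem CanExt.isCanonicalExtension (L : Type*) [DistribLattice L] [BoundedOrder L] :
    IsCanonicalExtension (CanExt.stone L) where
  injective a b hab := by
    have h : ∀ x : PrimeFilter L, a ∈ x.1 ↔ b ∈ x.1 :=
      fun x => Set.ext_iff.1 (congrArg Subtype.val hab) x
    exact le_antisymm (PrimeFilter.le_of_forall fun x => (h x).1)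
      (PrimeFilter.le_of_forall fun x => (h x).2)
  dense_join_of_meets u := by
    refine ⟨{S | ∃ x ∈ u.1, S = (x.1 : Set L)}, Subtype.ext (Set.ext fun y => ?_)⟩
    simp only [CompleteSublattice.coe_iSup, CompleteSublattice.coe_iInf, Set.iSup_eq_iUnion,
      Set.iInf_eq_iInter, Set.mem_iUnion, Set.mem_iInter]
    constructor
    · intro hy
      exact ⟨_, ⟨y, hy, rfl⟩, fun a ha => ha⟩
    · rintro ⟨_, ⟨x, hx, rfl⟩, h⟩
      have hxy : x ≤ y := fun a ha => h a ha
      exact u.2 hxy hx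
  dense_meet_of_joins u := by
    refine ⟨{S | ∃ x ∉ u.1, S = (x.1 : Set L)ᶜ}, Subtype.ext (Set.ext fun y => ?_)⟩
    simp only [CompleteSublattice.coe_iSup, CompleteSublattice.coe_iInf, Set.iSup_eq_iUnion,
      Set.iInf_eq_iInter, Set.mem_iUnion, Set.mem_iInter]
    constructor
    · rintro hy _ ⟨x, hx, rfl⟩
      by_contra hcon
      have hyx : y ≤ x := fun a ha => by
        by_contra hax
        exact hcon ⟨a, hax, ha⟩
      exact hx (u.2 hyx hy)
    · intro h
      by_contra hy
      obtain ⟨a, ha, ha'⟩ := h _ ⟨y, hy, rfl⟩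
      exact ha ha'
  compact S T h := by
    obtain ⟨S', T', hS, hT, hle⟩ := PrimeFilter.compact S T (fun x hx => by
      have hx' : x ∈ (⨅ a ∈ S, CanExt.stone L a : CanExt L).1 := by
        simp only [CompleteSublattice.coe_iInf, Set.iInf_eq_iInter, Set.mem_iInter]
        exact fun a ha => hx ha
      have hx'' := h hx'
      simp only [CompleteSublattice.coe_iSup, Set.iSup_eq_iUnion, Set.mem_iUnion] at hx''
      obtain ⟨b, hb, hbx⟩ := hx''
      exact ⟨b, hb, hbx⟩)
    refine ⟨S', T', hS, hT, ?_⟩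
    have h₁ := OrderHomClass.mono (CanExt.stone L) hle
    rw [map_finset_inf, map_finset_sup] at h₁
    exact h₁

/-- `B^δ` is a canonical extension of `B`. -/
theorem BoolCanExt.isCanonicalExtension (B : Type*) [BooleanAlgebra B] :
    IsCanonicalExtension (BoolCanExt.stone B) where
  injective a b hab := (CanExt.isCanonicalExtension B).injective (Subtype.ext hab)
  dense_join_of_meets u := by
    obtain ⟨𝒮, h⟩ := (CanExt.isCanonicalExtension B).dense_join_of_meets ⟨u, u.mem_canExt⟩
    refine ⟨𝒮, (congrArg Subtype.val h).trans ?_⟩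
    simp only [CompleteSublattice.coe_iSup, CompleteSublattice.coe_iInf]
    rfl
  dense_meet_of_joins u := by
    obtain ⟨𝒮, h⟩ := (CanExt.isCanonicalExtension B).dense_meet_of_joins ⟨u, u.mem_canExt⟩
    refine ⟨𝒮, (congrArg Subtype.val h).trans ?_⟩
    simp only [CompleteSublattice.coe_iSup, CompleteSublattice.coe_iInf]
    rfl
  compact S T h := by
    obtain ⟨S', T', hS, hT, hle⟩ := PrimeFilter.compact S T (fun x hx => by
      have hx' : x ∈ (⨅ a ∈ S, BoolCanExt.stone B a) := by
        simp only [Set.iInf_eq_iInter, Set.mem_iInter]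
        exact fun a ha => hx ha
      have hx'' := h hx'
      simp only [Set.iSup_eq_iUnion, Set.mem_iUnion] at hx''
      obtain ⟨b, hb, hbx⟩ := hx''
      exact ⟨b, hb, hbx⟩)
    refine ⟨S', T', hS, hT, ?_⟩
    have h₁ := OrderHomClass.mono (BoolCanExt.stone B) hle
    rw [map_finset_inf, map_finset_sup] at h₁
    exact h₁

/-! ### Bounded sublattices of a Boolean algebra and the closure operator on `B^δ` -/

/-- A bounded sublattice of `B`: a sublattice that contains the bottom and the top of `B`. -/
structure BoundedSublattice (B : Type*) [Lattice B] [BoundedOrder B] extends Sublattice B where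
  bot_mem' : ⊥ ∈ carrier
  top_mem' : ⊤ ∈ carrier

namespace BoundedSublattice

instance {B : Type*} [Lattice B] [BoundedOrder B] : SetLike (BoundedSublattice B) B where
  coe D := D.carrier
  coe_injective D E h := by
    obtain ⟨⟨_, _, _⟩, _, _⟩ := D
    obtain ⟨⟨_, _, _⟩, _, _⟩ := E
    congr

instance {B : Type*} [BooleanAlgebra B] (D : BoundedSublattice B) : DistribLattice D :=
  inferInstanceAs (DistribLattice D.toSublattice)

instance {B : Type*} [BooleanAlgebra B] (D : BoundedSublattice B) : BoundedOrder D where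
  top := ⟨⊤, D.top_mem'⟩
  bot := ⟨⊥, D.bot_mem'⟩
  le_top a := (le_top : (a : B) ≤ ⊤)
  bot_le a := (bot_le : ⊥ ≤ (a : B))

variable {B : Type*} [BooleanAlgebra B] (D : BoundedSublattice B)

/-- The inclusion of `D` in `B`. -/
def incl : BoundedLatticeHom D B where
  toFun a := a
  map_sup' _ _ := rfl
  map_inf' _ _ := rfl
  map_top' := rfl
  map_bot' := rfl

/-- The complete embedding `D^δ ↪ B^δ` that extends the inclusion of `D` in `B`: inverse image
under the restriction `x ↦ x ∩ D` of prime filters. -/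
def deltaIncl : CompleteLatticeHom (CanExt D) (BoolCanExt B) where
  toFun u := PrimeFilter.comap D.incl ⁻¹' u.1
  map_sSup' s := by
    ext x
    simp [CompleteSublattice.coe_sSup]
  map_sInf' s := by
    ext x
    simp [CompleteSublattice.coe_sInf]

theorem deltaIncl_stone (a : D) :
    D.deltaIncl (CanExt.stone D a) = BoolCanExt.stone B (a : B) := rfl

theorem deltaIncl_injective : Function.Injective D.deltaIncl := by
  classical
  have hsurj : Function.Surjective (PrimeFilter.comap D.incl) := by
    intro y
    by_contra hcon
    obtain ⟨S', T', hS, hT, hle⟩ := PrimeFilter.compact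
      ((fun a : D => (a : B)) '' {a | a ∈ y.1}) ((fun a : D => (a : B)) '' {a | a ∉ y.1})
      (fun x hx => by
        by_contra hno
        refine hcon ⟨x, le_antisymm (fun a ha => ?_) (fun a ha => hx ⟨a, ha, rfl⟩)⟩
        by_contra hay
        exact hno ⟨a, ⟨a, hay, rfl⟩, ha⟩)
    obtain ⟨S₁, hS₁, rfl⟩ := Finset.subset_set_image_iff.1 hS
    obtain ⟨T₁, hT₁, rfl⟩ := Finset.subset_set_image_iff.1 hT
    have h₁ : S₁.inf id ≤ T₁.sup id := by
      have e₁ : ((S₁.inf id : D) : B) = S₁.inf (fun a => (a : B)) := map_finset_inf D.incl S₁ id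
      have e₂ : ((T₁.sup id : D) : B) = T₁.sup (fun a => (a : B)) := map_finset_sup D.incl T₁ id
      rw [Finset.inf_image, Finset.sup_image] at hle
      change ((S₁.inf id : D) : B) ≤ ((T₁.sup id : D) : B)
      rw [e₁, e₂]
      exact hle
    have h₂ : S₁.inf id ∈ y.1 :=
      Finset.inf_induction y.1.top_mem (fun _ ha _ hb => Order.PFilter.inf_mem ha hb)
        (fun a ha => hS₁ ha)
    have h₃ : T₁.sup id ∉ y.1 :=
      Finset.sup_induction (p := fun a => a ∉ y.1) y.bot_notMem
        (fun a ha b hb h => ((y.sup_mem_iff a b).1 h).elim ha hb) (fun a ha => hT₁ ha)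
    exact h₃ (Order.PFilter.mem_of_le h₁ h₂)
  exact fun u v h => Subtype.ext (hsurj.preimage_injective h)

/-- The lower adjoint `v ↦ ⋀ {u ∈ D^δ ∣ v ≤ u}` of the embedding `D^δ ↪ B^δ`. -/
def deltaLower (v : BoolCanExt B) : CanExt D := sInf {u | v ≤ D.deltaIncl u}

theorem gc_deltaLower : GaloisConnection D.deltaLower D.deltaIncl := by
  intro v u
  constructor
  · intro h
    refine le_trans ?_ (OrderHomClass.mono D.deltaIncl h)
    rw [deltaLower, map_sInf]
    exact le_sInf (by rintro _ ⟨w, hw, rfl⟩; exact hw)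
  · intro h
    exact sInf_le h

/-- The closure operator `v ↦ v̄` on `B^δ` with values in `D^δ`, where `D^δ` is seen inside
`B^δ`. -/
def deltaClosure (v : BoolCanExt B) : BoolCanExt B := D.deltaIncl (D.deltaLower v)

end BoundedSublattice

/-! ### Difference chains -/

/-- For an operator `cl` and an element `b` of a Boolean algebra, the sequence
`a₁ = cl b`, `a₂ₙ = cl (a₂ₙ₋₁ - b)`, `a₂ₙ₊₁ = cl (a₂ₙ ∧ b)`, for `n ≥ 1`.
The entry at index `0` is not used. -/
def alternatingSeq {α : Type*} [BooleanAlgebra α] (cl : α → α) (b : α) : ℕ → α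
  | 0 => ⊤
  | 1 => cl b
  | n + 2 =>
    if Even n then cl (alternatingSeq cl b (n + 1) \ b) else cl (alternatingSeq cl b (n + 1) ⊓ b)

/-- `diffChain a n` is `a₁ - (a₂ - (… - (aₙ₋₁ - aₙ)…))`. -/
def diffChain {α : Type*} [BooleanAlgebra α] (a : ℕ → α) : ℕ → α
  | 0 => ⊥
  | n + 1 => a 1 \ diffChain (fun k => a (k + 1)) n

/-- The sequence `k₁, k₂, …` in `B^δ` obtained from `b` and the closure into `D^δ`. -/
def canonicalSeq {B : Type*} [BooleanAlgebra B] (D : BoundedSublattice B) (b : B) :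
    ℕ → BoolCanExt B :=
  alternatingSeq D.deltaClosure (BoolCanExt.stone B b)

/-- The sequence `c₁, c₂, …` in `B` obtained from `b` and the closure operator `g f` of an
adjunction `f : B ⇄ S : g`. -/
def adjunctionSeq {B S : Type*} [BooleanAlgebra B] (f : B → S) (g : S → B) (b : B) : ℕ → B :=
  alternatingSeq (fun x => g (f x)) b

/-!
The two sequences of the theorem are the same construction carried out for two closure operators,
`v ↦ v̄` on `B^δ` and `g_j f_j` on `B`. With the convention `k₀ = ⊤`, the construction reads
`k_{n+1} = cl (kₙ ⊓ bₙ)`, where `bₙ` is `b` for even `n` and `bᶜ` for odd `n` (`altCompl`).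
Hence `k` is the smallest of all sequences `a` of closed elements with `a₀ = ⊤` and
`aₙ ⊓ bₙ ≤ a_{n+1}` (`IsAltChain`, `IsAltChain.alternatingSeq_le`). It is moreover decreasing, and
as soon as it reaches `⊥` it expresses `b` in both of the required forms (`IsAltChain.eq_diffChain`,
`IsAltChain.eq_sup_sdiff`).

It is therefore enough to find one such sequence `a` in `D` that ends in `⊥`: only finitely many
elements of `D` occur in it, so by directedness they are closed for `g_j f_j` for all large `j`,
and they are always closed for `v ↦ v̄`. The elements `b` that admit such a sequence
(`HasFiniteAltChain`) are closed under complements (shift the sequence by one), under meets with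
elements of `D`, and under symmetric differences: for the last, take
`⨆ i + j = k, aᵢ ⊓ a'ⱼ`, as every alternation of `b ∆ c` comes from one of `b` or of `c`.
As every element of the Booleanization is a finite join of differences of elements of `D`, this
covers all of `D⁻`.
-/

open scoped symmDiff

/-! ### Alternating chains -/

section AltChain

variable {α : Type*} [BooleanAlgebra α]

/-- The alternating sequence `b, bᶜ, b, bᶜ, …`. -/
def altCompl (b : α) (n : ℕ) : α := if Even n then b else bᶜ

@[simp] theorem altCompl_zero (b : α) : altCompl b 0 = b := by simp [altCompl]

theorem altCompl_succ (b : α) (n : ℕ) : altCompl b (n + 1) = altCompl bᶜ n := by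
  by_cases h : Even n <;> simp [altCompl, h, Nat.even_add_one]

theorem altCompl_compl_succ (b : α) (n : ℕ) : altCompl bᶜ (n + 1) = altCompl b n := by
  rw [altCompl_succ, compl_compl]

theorem altCompl_two_mul (b : α) (n : ℕ) : altCompl b (2 * n) = b := by simp [altCompl]

theorem altCompl_two_mul_add_one (b : α) (n : ℕ) : altCompl b (2 * n + 1) = bᶜ := by
  rw [altCompl_succ, altCompl_two_mul]

/-- An alternation of `b ∆ c` at stage `i + j` comes from one of `b` at stage `i` or one of `c` at
stage `j`. -/
theorem altCompl_symmDiff_le (b c : α) (i j : ℕ) :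
    altCompl (b ∆ c) (i + j) ≤ altCompl b i ⊔ altCompl c j := by
  by_cases hi : Even i <;> by_cases hj : Even j <;> simp only [altCompl, Nat.even_add, hi, hj,
    iff_self, iff_true, iff_false, not_true_eq_false, if_true, if_false]
  · exact symmDiff_le_sup
  · refine compl_le_of_compl_le ?_
    rw [compl_sup, compl_compl, inf_comm, ← sdiff_eq]
    exact le_sup_right
  · refine compl_le_of_compl_le ?_
    rw [compl_sup, compl_compl, ← sdiff_eq]
    exact le_sup_left
  · rw [← compl_inf, symmDiff_eq_sup_sdiff_inf, sdiff_eq]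
    exact inf_le_right

/-- A sequence `⊤ = a₀, a₁, a₂, …` such that `a₀ ⊓ b ≤ a₁`, `a₁ ⊓ bᶜ ≤ a₂`, `a₂ ⊓ b ≤ a₃`, and so
on. It is not required to be decreasing. -/
structure IsAltChain (b : α) (a : ℕ → α) : Prop where
  zero : a 0 = ⊤
  inf_le : ∀ n, a n ⊓ altCompl b n ≤ a (n + 1)

theorem alternatingSeq_zero (cl : α → α) (b : α) : alternatingSeq cl b 0 = ⊤ := by
  simp [alternatingSeq]

theorem alternatingSeq_succ (cl : α → α) (b : α) (n : ℕ) :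
    alternatingSeq cl b (n + 1) = cl (alternatingSeq cl b n ⊓ altCompl b n) := by
  rcases n with _ | n
  · simp [alternatingSeq]
  · rw [alternatingSeq]
    by_cases h : Even n <;> simp [altCompl, h, Nat.even_add_one, sdiff_eq]

theorem isAltChain_alternatingSeq (cl : ClosureOperator α) (b : α) :
    IsAltChain b (alternatingSeq cl b) where
  zero := alternatingSeq_zero cl b
  inf_le n := by
    rw [alternatingSeq_succ]
    exact cl.le_closure _

theorem antitone_alternatingSeq (cl : ClosureOperator α) (b : α) :
    Antitone (alternatingSeq cl b) := by
  refine antitone_nat_of_succ_le fun n => ?_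
  rcases n with _ | n
  · rw [alternatingSeq_zero]
    exact le_top
  · rw [alternatingSeq_succ _ _ (n + 1)]
    refine (cl.monotone inf_le_left).trans ?_
    rw [alternatingSeq_succ, cl.idempotent]

namespace IsAltChain

variable {b c : α} {a a' : ℕ → α}

/-- The alternating sequence of `b` is the least alternating chain of closed elements. -/
theorem alternatingSeq_le (ha : IsAltChain b a) (cl : ClosureOperator α)
    (hcl : ∀ n, cl (a n) ≤ a n) (n : ℕ) : alternatingSeq cl b n ≤ a n := by
  induction n with
  | zero => rw [ha.zero]; exact le_top
  | succ n ih =>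
    rw [alternatingSeq_succ]
    exact (cl.monotone ((inf_le_inf_right _ ih).trans (ha.inf_le n))).trans (hcl _)

/-- `⊤, a₀, a₁, …` is an alternating chain for `bᶜ`. -/
theorem compl (ha : IsAltChain b a) : IsAltChain bᶜ (fun n => Nat.casesOn n ⊤ a) where
  zero := rfl
  inf_le n := by
    rcases n with _ | n
    · simp [ha.zero]
    · rw [altCompl_compl_succ]
      exact ha.inf_le n

/-- `⊤, a₁ ⊓ d, a₂ ⊓ d, …` is an alternating chain for `b ⊓ d`. -/
theorem inf_right (ha : IsAltChain b a) (d : α) :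
    IsAltChain (b ⊓ d) (fun n => Nat.casesOn n ⊤ fun k => a (k + 1) ⊓ d) where
  zero := rfl
  inf_le n := by
    rcases n with _ | n
    · have h := ha.inf_le 0
      rw [ha.zero, top_inf_eq, altCompl_zero] at h
      simpa using inf_le_of_left_le h
    · have h : d ⊓ altCompl (b ⊓ d) (n + 1) ≤ altCompl b (n + 1) := by
        by_cases hn : Even (n + 1)
        · simp only [altCompl, hn, if_true]
          exact inf_le_right.trans inf_le_left
        · simp only [altCompl, hn, if_false, compl_inf, inf_sup_left, inf_compl_self, sup_bot_eq]
          exact inf_le_right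
      refine le_inf (le_trans ?_ (ha.inf_le (n + 1))) (inf_le_left.trans inf_le_right)
      rw [inf_assoc]
      exact inf_le_inf_left _ h

theorem symmDiff (ha : IsAltChain b a) (ha' : IsAltChain c a') :
    IsAltChain (b ∆ c)
      (fun n => (Finset.HasAntidiagonal.antidiagonal n).sup fun p => a p.1 ⊓ a' p.2) where
  zero := by simp [ha.zero, ha'.zero]
  inf_le n := by
    rw [Finset.sup_inf_distrib_right]
    refine Finset.sup_le fun ⟨i, j⟩ hij => ?_
    rw [Finset.HasAntidiagonal.mem_antidiagonal] at hij
    subst hij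
    refine (inf_le_inf_left _ (altCompl_symmDiff_le b c i j)).trans ?_
    rw [inf_sup_left]
    refine sup_le ?_ ?_
    · refine le_trans ?_ (Finset.le_sup (b := (i + 1, j)) (by simp; omega))
      exact le_inf ((inf_le_inf_right _ inf_le_left).trans (ha.inf_le i))
        (inf_le_left.trans inf_le_right)
    · refine le_trans ?_ (Finset.le_sup (b := (i, j + 1)) (by simp; omega))
      exact le_inf (inf_le_left.trans inf_le_left)
        ((inf_le_inf_right _ inf_le_right).trans (ha'.inf_le j))

end IsAltChain

/-- Stated for a sequence with arbitrary initial term, as the induction passes from `b` and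
`a₀, a₁, …` to `bᶜ` and `a₁, a₂, …`. -/
theorem inf_eq_diffChain {n : ℕ} {b : α} {a : ℕ → α} (hanti : Antitone a)
    (ha : ∀ n, a n ⊓ altCompl b n ≤ a (n + 1)) (hn : a n = ⊥) :
    a 0 ⊓ b = diffChain a n := by
  induction n generalizing a b with
  | zero => simp [diffChain, hn]
  | succ n ih =>
    have h := ih (b := bᶜ) (a := fun k => a (k + 1)) (fun _ _ h => hanti (by omega))
      (fun k => by rw [← altCompl_succ]; exact ha (k + 1)) hn
    rw [diffChain, ← h, sdiff_inf_self_left, sdiff_compl]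
    have h₀ := ha 0
    rw [altCompl_zero] at h₀
    exact le_antisymm (le_inf h₀ inf_le_right) (inf_le_inf_right _ (hanti (Nat.le_succ 0)))

namespace IsAltChain

variable {b : α} {a : ℕ → α} {m : ℕ}

theorem eq_diffChain (ha : IsAltChain b a) (hanti : Antitone a) {n : ℕ} (hn : a n = ⊥) :
    b = diffChain a n := by
  rw [← inf_eq_diffChain hanti ha.inf_le hn, ha.zero, top_inf_eq]

theorem le_sup_sdiff_sup (ha : IsAltChain b a) (m : ℕ) :
    b ≤ (Finset.Icc 1 m).sup (fun l => a (2 * l - 1) \ a (2 * l)) ⊔ a (2 * m) := by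
  induction m with
  | zero => simp [ha.zero]
  | succ m ih =>
    rw [← Finset.insert_Icc_right_eq_Icc_add_one (by omega), Finset.sup_insert]
    have h := ha.inf_le (2 * m)
    rw [altCompl_two_mul] at h
    have h' : a (2 * m + 1) ≤ a (2 * m + 1) \ a (2 * (m + 1)) ⊔ a (2 * (m + 1)) :=
      le_sdiff_sup
    calc b ≤ ((Finset.Icc 1 m).sup (fun l => a (2 * l - 1) \ a (2 * l)) ⊔ a (2 * m)) ⊓ b :=
          le_inf ih le_rfl
      _ ≤ (Finset.Icc 1 m).sup (fun l => a (2 * l - 1) \ a (2 * l)) ⊔ a (2 * m + 1) := by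
          rw [inf_sup_right]
          exact sup_le_sup inf_le_left h
      _ ≤ _ := by
          rw [sup_right_comm, sup_comm]
          exact sup_le_sup_right h' _

theorem eq_sup_sdiff (ha : IsAltChain b a) (hm : a (2 * m) = ⊥) :
    b = (Finset.Icc 1 m).sup (fun l => a (2 * l - 1) \ a (2 * l)) := by
  -- The stages `2 * l - 1` give `≥`, the stages `2 * l` give `≤`.
  refine le_antisymm (by simpa [hm] using ha.le_sup_sdiff_sup m) (Finset.sup_le fun l hl => ?_)
  obtain ⟨k, rfl⟩ : ∃ k, l = k + 1 := ⟨l - 1, by have := (Finset.mem_Icc.1 hl).1; omega⟩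
  have h := ha.inf_le (2 * k + 1)
  rw [altCompl_two_mul_add_one, ← sdiff_eq] at h
  exact sdiff_le_comm.1 h

end IsAltChain

end AltChain

/-! ### Alternating chains in a bounded sublattice -/

/-- `b` admits an alternating chain of elements of `D` that is eventually `⊥`. -/
def HasFiniteAltChain {B : Type*} [BooleanAlgebra B] (D : BoundedSublattice B) (b : B) : Prop :=
  ∃ a : ℕ → B, IsAltChain b a ∧ (∀ n, a n ∈ D) ∧ ∃ N, ∀ n, N ≤ n → a n = ⊥

namespace HasFiniteAltChain

variable {B : Type*} [BooleanAlgebra B] {D : BoundedSublattice B} {b c d : B}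

theorem bot : HasFiniteAltChain D (⊥ : B) := by
  refine ⟨fun n => Nat.casesOn n ⊤ fun _ => ⊥, ⟨rfl, ?_⟩, ?_, 1, ?_⟩
  · rintro (_ | n) <;> simp
  · rintro (_ | n)
    exacts [D.top_mem', D.bot_mem']
  · rintro (_ | n) h
    exacts [absurd h (by omega), rfl]

theorem compl (hb : HasFiniteAltChain D b) : HasFiniteAltChain D bᶜ := by
  obtain ⟨a, ha, haD, N, hN⟩ := hb
  refine ⟨_, ha.compl, ?_, N + 1, ?_⟩
  · rintro (_ | n)
    exacts [D.top_mem', haD n]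
  · rintro (_ | n) h
    exacts [absurd h (by omega), hN n (by omega)]

theorem inf_right (hb : HasFiniteAltChain D b) (hd : d ∈ D) : HasFiniteAltChain D (b ⊓ d) := by
  obtain ⟨a, ha, haD, N, hN⟩ := hb
  refine ⟨_, ha.inf_right d, ?_, N + 1, ?_⟩
  · rintro (_ | n)
    exacts [D.top_mem', D.infClosed' (haD (n + 1)) hd]
  · rintro (_ | n) h
    · omega
    · simp [hN (n + 1) (by omega)]

theorem symmDiff (hb : HasFiniteAltChain D b) (hc : HasFiniteAltChain D c) :
    HasFiniteAltChain D (b ∆ c) := by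
  obtain ⟨a, ha, haD, N, hN⟩ := hb
  obtain ⟨a', ha', haD', M, hM⟩ := hc
  refine ⟨_, ha.symmDiff ha', fun n => ?_, N + M, fun n hn => ?_⟩
  · exact Finset.sup_induction D.bot_mem' (fun x hx y hy => D.supClosed' hx hy)
      (fun p _ => D.infClosed' (haD p.1) (haD' p.2))
  · refine (Finset.sup_eq_bot_iff _ _).2 fun p hp => ?_
    rw [Finset.HasAntidiagonal.mem_antidiagonal] at hp
    rcases le_or_gt N p.1 with h | h
    · simp [hN _ h]
    · simp [hM p.2 (by omega)]

theorem inf_sdiff (hb : HasFiniteAltChain D b) (hc : c ∈ D) (hd : d ∈ D) :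
    HasFiniteAltChain D (b ⊓ (c \ d)) := by
  have h : b ⊓ (c \ d) = (b ⊓ c) ∆ (b ⊓ c ⊓ d) := by
    rw [symmDiff_of_ge inf_le_left, sdiff_inf_self_left, inf_sdiff_assoc]
  rw [h]
  exact (hb.inf_right hc).symmDiff ((hb.inf_right hc).inf_right hd)

theorem sup_sdiff (hb : HasFiniteAltChain D b) (hc : c ∈ D) (hd : d ∈ D) :
    HasFiniteAltChain D (b ⊔ c \ d) := by
  have htop : HasFiniteAltChain D (⊤ : B) := by simpa using (bot (D := D)).compl
  -- `x ⊔ y = x ∆ y ∆ (x ⊓ y)`, and a meet with `c \ d` is the symmetric difference of two meets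
  -- with elements of `D`.
  rw [← symmDiff_symmDiff_inf]
  exact (hb.symmDiff (by simpa using htop.inf_sdiff hc hd)).symmDiff (hb.inf_sdiff hc hd)

/-- Every element of the Booleanization of `D` is an alternating difference of a finite chain of
elements of `D`. -/
theorem of_mem_closure (hb : b ∈ BooleanSubalgebra.closure (D : Set B)) :
    HasFiniteAltChain D b := by
  obtain ⟨t, rfl⟩ := (BooleanSubalgebra.mem_closure_iff_sup_sdiff D.toSublattice.isSublattice
    D.bot_mem' D.top_mem').1 hb
  classical
  refine t.induction (by simpa using bot) fun x t _ ih => ?_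
  rw [Finset.sup_insert, sup_comm]
  exact ih.sup_sdiff x.1.2 x.2.2

end HasFiniteAltChain

/-! ### The closure operators -/

/-- The closure operator `v ↦ v̄` on `B^δ`. -/
def BoundedSublattice.deltaClosureOperator {B : Type*} [BooleanAlgebra B]
    (D : BoundedSublattice B) : ClosureOperator (BoolCanExt B) :=
  D.gc_deltaLower.closureOperator

theorem BoundedSublattice.deltaClosure_stone {B : Type*} [BooleanAlgebra B]
    (D : BoundedSublattice B) {a : B} (ha : a ∈ D) :
    D.deltaClosure (BoolCanExt.stone B a) = BoolCanExt.stone B a :=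
  D.gc_deltaLower.u_l_u_eq_u (CanExt.stone D ⟨a, ha⟩)

theorem IsAltChain.stone {B : Type*} [BooleanAlgebra B] {b : B} {a : ℕ → B}
    (ha : IsAltChain b a) :
    IsAltChain (BoolCanExt.stone B b) (fun n => BoolCanExt.stone B (a n)) where
  zero := by simp [ha.zero]
  inf_le n := by
    have h : altCompl (BoolCanExt.stone B b) n = BoolCanExt.stone B (altCompl b n) := by
      by_cases hn : Even n <;> simp [altCompl, hn]
    rw [h, ← map_inf]
    exact OrderHomClass.mono _ (ha.inf_le n)

/-- In a directed union of sets, finitely many elements, here the values of an eventually constant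
sequence, lie in a common member and in all later ones. -/
theorem exists_forall_ge_forall_mem {β I : Type*} [PartialOrder I] [IsDirectedOrder I]
    {R : I → Set β} (hR : ∀ i j, i ≤ j → R i ⊆ R j) {a : ℕ → β} (ha : ∀ n, a n ∈ ⋃ i, R i)
    {N : ℕ} {z : β} (hN : ∀ n, N ≤ n → a n = z) : ∃ i, ∀ j, i ≤ j → ∀ n, a n ∈ R j := by
  simp only [Set.mem_iUnion] at ha
  choose ι hι using ha
  classical
  have : Nonempty I := ⟨ι 0⟩
  obtain ⟨i, hi⟩ := ((Finset.range (N + 1)).image ι).exists_le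
  refine ⟨i, fun j hij n => ?_⟩
  rw [show a n = a (min n N) by rcases le_total n N with h | h <;> simp [h, hN]]
  exact hR _ _ ((hi _ (Finset.mem_image_of_mem ι (by simp))).trans hij) (hι _)

theorem mainTheorem2 {B : Type*} [BooleanAlgebra B] {I : Type*} [PartialOrder I]
    [IsDirectedOrder I] {S : I → Type*} [∀ i, SemilatticeInf (S i)]
    (f : ∀ i, B → S i) (g : ∀ i, S i → B) (hfg : ∀ i, GaloisConnection (f i) (g i))
    (hmono : ∀ i j, i ≤ j → Set.range (g i) ⊆ Set.range (g j))
    (D : BoundedSublattice B) (hD : ⋃ i, Set.range (g i) = (D : Set B))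
    (b : B) (hb : b ∈ BooleanSubalgebra.closure (D : Set B)) :
    ∃ m : ℕ, 1 ≤ m ∧
      (∀ n, 1 ≤ n → canonicalSeq D b (n + 1) ≤ canonicalSeq D b n) ∧
      BoolCanExt.stone B b = diffChain (canonicalSeq D b) (2 * m) ∧
      BoolCanExt.stone B b =
        (Finset.Icc 1 m).sup
          (fun l => canonicalSeq D b (2 * l - 1) \ canonicalSeq D b (2 * l)) ∧
      ∃ i : I, ∀ j : I, i ≤ j →
        (∀ n, 1 ≤ n → adjunctionSeq (f j) (g j) b (n + 1) ≤ adjunctionSeq (f j) (g j) b n) ∧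
        b = diffChain (adjunctionSeq (f j) (g j) b) (2 * m) ∧
        b = (Finset.Icc 1 m).sup
          (fun l => adjunctionSeq (f j) (g j) b (2 * l - 1) \
            adjunctionSeq (f j) (g j) b (2 * l)) := by
  obtain ⟨a, ha, haD, N, hN⟩ := HasFiniteAltChain.of_mem_closure hb
  have hbot : a (2 * (N + 1)) = ⊥ := hN _ (by omega)
  have hk : canonicalSeq D b (2 * (N + 1)) = ⊥ := by
    have h := ha.stone.alternatingSeq_le D.deltaClosureOperator
      (fun n => (D.deltaClosure_stone (haD n)).le) (2 * (N + 1))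
    simp only [hbot, map_bot] at h
    exact le_bot_iff.1 h
  have hkc : IsAltChain (BoolCanExt.stone B b) (canonicalSeq D b) :=
    isAltChain_alternatingSeq D.deltaClosureOperator _
  have hka : Antitone (canonicalSeq D b) := antitone_alternatingSeq D.deltaClosureOperator _
  refine ⟨N + 1, by omega, fun n _ => hka n.le_succ, hkc.eq_diffChain hka hk,
    hkc.eq_sup_sdiff hk, ?_⟩
  obtain ⟨i, hi⟩ := exists_forall_ge_forall_mem hmono (a := a)
    (fun n => by rw [hD]; exact haD n) hN
  refine ⟨i, fun j hij => ?_⟩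
  have hcl (n : ℕ) : (hfg j).closureOperator (a n) ≤ a n := by
    obtain ⟨s, hs⟩ := hi j hij n
    rw [← hs]
    exact ((hfg j).u_l_u_eq_u s).le
  have hc : adjunctionSeq (f j) (g j) b (2 * (N + 1)) = ⊥ :=
    le_bot_iff.1 (hbot ▸ ha.alternatingSeq_le (hfg j).closureOperator hcl (2 * (N + 1)))
  have hcc : IsAltChain b (adjunctionSeq (f j) (g j) b) :=
    isAltChain_alternatingSeq (hfg j).closureOperator _
  have hca : Antitone (adjunctionSeq (f j) (g j) b) :=
    antitone_alternatingSeq (hfg j).closureOperator _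
  exact ⟨fun n _ => hca n.le_succ, hcc.eq_diffChain hca hc, hcc.eq_sup_sdiff hc⟩
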